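/- Let $\overline{\mathbb C}=\mathbb C\cup\{\infty\}$. A matrix pencil $\mathcal A(s)=sE-A$ with $E,A\in\mathbb C^{n\times n}$ is called regular if $\det(sE-A)$ is not the zero polynomial. Its rank is the largest $r$ such that the polynomial matrix $sE-A$ has a minor of size $r$ that is not the zero polynomial. Its spectrum $\sigma(\mathcal A)\subseteq\overline{\mathbb C}$ consists of all $\lambda\in\mathbb C$ for which $0$ is an eigenvalue of $\lambda E-A$, together with $\infty$ if $E$ is singular. A Jordan chain of length $m\ge 1$ of $\mathcal A$ at $\lambda\in\mathbb C$ consists of vectors $g_0,\dots,g_{m-1}\in\mathbb C^n$ with $g_0\ne 0$, $(A-\lambda E)g_0=0$ and $(A-\lambda E)g_{i+1}=Eg_i$ for $0\le i\le m-2$; a Jordan chain of length $m$ at $\infty$ consists of vectors with $g_0\neq 0$, $Eg_0=0$ and $Eg_{i+1}=Ag_i$ for $0\le i\le m-2$. Let $\mathcal L_\lambda(\mathcal A)$ be the subspace of $\mathbb C^n$ formed by the zero vector and all elements of all Jordan chains of $\mathcal A$ at $\lambda\in\overline{\mathbb C}$. For a regular pencil $\mathcal A$ and $\lambda\in\sigma(\mathcal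 A)$ let $m_1(\lambda)$ be the length of the longest Jordan chain of $\mathcal A$ at $\lambda$, and put $M(\mathcal A)=\sum_{\mu\in\sigma(\mathcal A)}m_1(\mu)$ (the spectrum of a regular pencil is finite). Theorem. Let $\mathcal A(s)=sE-A$ be a regular matrix pencil with $E,A\in\mathbb C^{n\times n}$, and let $\mathcal P(s)=sF-G$ with $F,G\in\mathbb C^{n\times n}$ be a pencil of rank one such that $(\mathcal A+\mathcal P)(s)=s(E+F)-(A+G)$ is regular. Then for every $\lambda\in\sigma(\mathcal A)$ $$\dim\mathcal L_\lambda(\mathcal A)-m_1(\lambda)\le\dim\mathcal L_\lambda(\mathcal A+\mathcal P)\le\dim\mathcal L_\lambda(\mathcal A)+M(\mathcal A)-m_1(\lambda),$$ and for every $\lambda\in\overline{\mathbb C}\setminus\sigma(\mathcal A)$ $$0\le\dim\mathcal L_\lambda(\mathcal A+\mathcal P)\le M(\mathcal A).$$ Moreover, $$\sum_{\lambda\in\sigma(\mathcal A)}\dim\mathcal L_\lambda(\mathcal A+\mathcal P)\ge n-M(\mathcal A),\qquad \sum_{\lambda\in\sigma(\mathcal A+\mathcal P)\setminus\sigma(\mathcal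 A)}\dim\mathcal L_\lambda(\mathcal A+\mathcal P)\le M(\mathcal A).$$ -/

import Mathlib

/-- A square matrix pencil `s E - A` with `E, A ∈ ℂ^{n × n}`. -/
@[ext]
structure MatrixPencil (n : ℕ) where
  /-- the coefficient of `s` -/
  E : Matrix (Fin n) (Fin n) ℂ
  /-- minus the constant coefficient -/
  A : Matrix (Fin n) (Fin n) ℂ

namespace MatrixPencil

open Polynomial

variable {n : ℕ}

/-- `(sE - A) + (sF - G) = s(E + F) - (A + G)`. -/
instance : Add (MatrixPencil n) := ⟨fun 𝒜 P => ⟨𝒜.E + P.E, 𝒜.A + P.A⟩⟩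

/-- The value `z E - A` of the pencil at a complex number `z`. -/
def eval (𝒜 : MatrixPencil n) (z : ℂ) : Matrix (Fin n) (Fin n) ℂ := z • 𝒜.E - 𝒜.A

/-- The pencil `s E - A` as a matrix with polynomial entries. -/
noncomputable def toPolyMatrix (𝒜 : MatrixPencil n) : Matrix (Fin n) (Fin n) ℂ[X] :=
  (X : ℂ[X]) • 𝒜.E.map C - 𝒜.A.map C

/-- The pencil is regular: its characteristic polynomial `det (s E - A)` is not zero. -/
def IsRegular (𝒜 : MatrixPencil n) : Prop := 𝒜.toPolyMatrix.det ≠ 0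

/-- The rank of a pencil: the largest `r` such that some minor of size `r` of the polynomial matrix
`s E - A` is not the zero polynomial. (The empty minor is `1`, and `r ≤ n` for every minor.) -/
noncomputable def rank (𝒜 : MatrixPencil n) : ℕ :=
  sSup {r : ℕ | ∃ f g : Fin r ↪ Fin n, (𝒜.toPolyMatrix.submatrix f g).det ≠ 0}

/-- The spectrum, a subset of `ℂ ∪ {∞}`: a complex number `z` belongs to it if `0` is an eigenvalue
of the matrix `z E - A`, and `∞` belongs to it if `E` is not invertible. -/
def spectrum (𝒜 : MatrixPencil n) : Set (OnePoint ℂ) :=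
  {l | match l with
    | OnePoint.some z => Module.End.HasEigenvalue (Matrix.toLin' (𝒜.eval z)) 0
    | OnePoint.infty => ¬ IsUnit 𝒜.E}

/-- `g 0, …, g (m - 1)` is a Jordan chain of length `m` of the pencil at a point of `ℂ ∪ {∞}`.
Only the values of `g` at indices below `m` are used. -/
def IsJordanChain (𝒜 : MatrixPencil n) (l : OnePoint ℂ) (m : ℕ) (g : ℕ → Fin n → ℂ) : Prop :=
  0 < m ∧ g 0 ≠ 0 ∧
    match l with
    | OnePoint.some z =>
        (𝒜.A - z • 𝒜.E).mulVec (g 0) = 0 ∧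
          ∀ i, i + 1 < m → (𝒜.A - z • 𝒜.E).mulVec (g (i + 1)) = 𝒜.E.mulVec (g i)
    | OnePoint.infty =>
        𝒜.E.mulVec (g 0) = 0 ∧
          ∀ i, i + 1 < m → 𝒜.E.mulVec (g (i + 1)) = 𝒜.A.mulVec (g i)

/-- The root subspace at `l`: the subspace of all elements of all Jordan chains at `l`. The span
only adds the zero vector to the set of these elements, see `coe_rootSubspace`. -/
def rootSubspace (𝒜 : MatrixPencil n) (l : OnePoint ℂ) : Submodule ℂ (Fin n → ℂ) :=
  Submodule.span ℂ {x | ∃ m g, 𝒜.IsJordanChain l m g ∧ ∃ j < m, g j = x}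

/-- The length of the longest Jordan chain at `l`. For a regular pencil the elements of a Jordan
chain are linearly independent, so that the lengths are bounded by `n`; there is no chain, and the
value is `0`, if `l` is not an eigenvalue. -/
noncomputable def maxChainLength (𝒜 : MatrixPencil n) (l : OnePoint ℂ) : ℕ :=
  sSup {m : ℕ | ∃ g, 𝒜.IsJordanChain l m g}

/-- The sum over all eigenvalues of the length of the longest Jordan chain. The spectrum of a
regular pencil is finite, see `IsRegular.finite_spectrum`. -/
noncomputable def sumMaxChainLength (𝒜 : MatrixPencil n) : ℕ :=
  ∑ᶠ l ∈ 𝒜.spectrum, 𝒜.maxChainLength l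

theorem eval_det_toPolyMatrix (𝒜 : MatrixPencil n) (z : ℂ) :
    𝒜.toPolyMatrix.det.eval z = (𝒜.eval z).det := by
  rw [← coe_evalRingHom, RingHom.map_det]
  congr 1
  ext i j
  simp [toPolyMatrix, eval]
  exact mul_comm _ _

theorem coe_mem_spectrum_iff (𝒜 : MatrixPencil n) (z : ℂ) :
    ((z : OnePoint ℂ) ∈ 𝒜.spectrum) ↔ 𝒜.toPolyMatrix.det.IsRoot z := by
  change Module.End.HasEigenvalue (Matrix.toLin' (𝒜.eval z)) 0 ↔ _
  rw [IsRoot.def, eval_det_toPolyMatrix, ← Matrix.exists_mulVec_eq_zero_iff]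
  constructor
  · intro h
    obtain ⟨v, hv⟩ := h.exists_hasEigenvector
    exact ⟨v, hv.2, by simpa using hv.apply_eq_smul⟩
  · rintro ⟨v, hv, h⟩
    refine Module.End.hasEigenvalue_of_hasEigenvector (x := v) ⟨?_, hv⟩
    rw [Module.End.mem_eigenspace_iff]
    simpa using h

theorem IsRegular.finite_spectrum {𝒜 : MatrixPencil n} (h : 𝒜.IsRegular) :
    𝒜.spectrum.Finite := by
  refine (((finite_setOfPred_isRoot h).image OnePoint.some).insert OnePoint.infty).subset ?_
  intro l hl
  induction l using OnePoint.rec with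
  | infty => exact Or.inl rfl
  | coe z => exact Or.inr ⟨z, (𝒜.coe_mem_spectrum_iff z).1 hl, rfl⟩

/-- The left and the right matrix in the recursion of Jordan chains at `l`. -/
def chainMatrices (𝒜 : MatrixPencil n) (l : OnePoint ℂ) :
    Matrix (Fin n) (Fin n) ℂ × Matrix (Fin n) (Fin n) ℂ :=
  match l with
  | OnePoint.some z => (𝒜.A - z • 𝒜.E, 𝒜.E)
  | OnePoint.infty => (𝒜.E, 𝒜.A)

theorem isJordanChain_iff (𝒜 : MatrixPencil n) (l : OnePoint ℂ) (m : ℕ) (g : ℕ → Fin n → ℂ) :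
    𝒜.IsJordanChain l m g ↔ 0 < m ∧ g 0 ≠ 0 ∧ (𝒜.chainMatrices l).1.mulVec (g 0) = 0 ∧
      ∀ i, i + 1 < m →
        (𝒜.chainMatrices l).1.mulVec (g (i + 1)) = (𝒜.chainMatrices l).2.mulVec (g i) := by
  induction l using OnePoint.rec <;> rfl

/-- The root subspace consists of the zero vector and the elements of Jordan chains. -/
theorem coe_rootSubspace (𝒜 : MatrixPencil n) (l : OnePoint ℂ) :
    (𝒜.rootSubspace l : Set (Fin n → ℂ)) =
      insert 0 {x | ∃ m g, 𝒜.IsJordanChain l m g ∧ ∃ j < m, g j = x} := by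
  set K := (𝒜.chainMatrices l).1
  set R := (𝒜.chainMatrices l).2
  -- reversed chains `x = h 0, h 1, …` that are eventually zero
  let W : Submodule ℂ (Fin n → ℂ) :=
    { carrier := {x | ∃ h : ℕ → Fin n → ℂ, h 0 = x ∧
        (∀ i, K.mulVec (h i) = R.mulVec (h (i + 1))) ∧ ∃ N, ∀ i, N ≤ i → h i = 0}
      zero_mem' := ⟨fun _ => 0, rfl, by simp, 0, by simp⟩
      add_mem' := by
        rintro x y ⟨h, hx, h1, N, hN⟩ ⟨h', hy, h1', N', hN'⟩
        refine ⟨h + h', by simp [hx, hy], fun i => ?_, max N N', fun i hi => ?_⟩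
        · simp [Matrix.mulVec_add, h1, h1']
        · simp [hN i (by omega), hN' i (by omega)]
      smul_mem' := by
        rintro c x ⟨h, hx, h1, N, hN⟩
        refine ⟨c • h, by simp [hx], fun i => ?_, N, fun i hi => ?_⟩
        · simp [Matrix.mulVec_smul, h1]
        · simp [hN i hi] }
  apply Set.Subset.antisymm
  · have hle : 𝒜.rootSubspace l ≤ W := by
      refine Submodule.span_le.2 ?_
      rintro x ⟨m, g, hg, j, hj, rfl⟩
      obtain ⟨-, -, h0, h1⟩ := (𝒜.isJordanChain_iff l m g).1 hg
      refine ⟨fun i => if i ≤ j then g (j - i) else 0, by simp, fun i => ?_, j + 1, fun i hi => ?_⟩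
      · rcases lt_trichotomy i j with h | h | h
        · have := h1 (j - (i + 1)) (by omega)
          rw [show j - (i + 1) + 1 = j - i by omega] at this
          simpa [h.le, Nat.succ_le_of_lt h] using this
        · subst h
          simpa using h0
        · simp [not_le.2 h, show ¬ (i + 1 ≤ j) by omega]
      · simp [show ¬ (i ≤ j) by omega]
    intro x hx
    obtain ⟨h, rfl, h1, hN⟩ := hle hx
    by_cases h0 : h 0 = 0
    · exact Or.inl h0
    right
    classical
    -- the first index at which the reversed chain vanishes
    have hex : ∃ N, h N = 0 := ⟨hN.choose, hN.choose_spec _ le_rfl⟩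
    have hm : h (Nat.find hex) = 0 := Nat.find_spec hex
    have hmin : ∀ i < Nat.find hex, h i ≠ 0 := fun i hi => Nat.find_min hex hi
    generalize Nat.find hex = m at hm hmin
    have hpos : 0 < m := by
      rcases Nat.eq_zero_or_pos m with rfl | hp
      · exact absurd hm h0
      · exact hp
    refine ⟨m, fun i => h (m - 1 - i), (𝒜.isJordanChain_iff l _ _).2
      ⟨hpos, hmin _ (by omega), ?_, fun i hi => ?_⟩, m - 1, by omega, by simp⟩
    · have := h1 (m - 1)
      rw [show m - 1 + 1 = m by omega, hm] at this
      simpa using this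
    · have := h1 (m - 1 - (i + 1))
      rwa [show m - 1 - (i + 1) + 1 = m - 1 - i by omega] at this
  · rintro x (rfl | hx)
    · exact zero_mem _
    · exact Submodule.subset_span hx

end MatrixPencil

/-! Moving a point `l` of the extended plane to `0` replaces the pencil by `X R - K`, where `(K, R)`
are the `chainMatrices`; let `v` be the order at `0` of its determinant `localDet`. Multiplication
by `(c R - K)⁻¹` turns the Jordan chains at `l` into generalized eigenvectors at `0` of one matrix,
so the root subspace has dimension `v` (`finrank_rootSubspace`).

The inverse of `X R - K` has a pole at `0` of order at most the longest chain length `m₁`, hence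
every entry of the adjugate vanishes to order at least `v - m₁` (`X_pow_dvd_adjugate`). A rank one
perturbation changes the determinant by a combination of adjugate entries
(`det_add_of_minor_two_eq_of_isDomain`), so the perturbed determinant still vanishes to that order.
This is the lower bound, valid at every point (`IsRegular.finrank_rootSubspace_le_add`).

The other bounds are counting: the root subspaces of either pencil have total dimension `n`
(`IsRegular.sum_finrank_rootSubspace`), so a gain at some points is paid for by losses at others,
which total at most `M`. -/

namespace MatrixPencil

open Polynomial

/-! ### Pencil determinants and orders of vanishing at zero -/

/-- The determinant `det (X R - K)` of the pencil with coefficients `R` and `K`. -/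
noncomputable def pencilDet {n : ℕ} (K R : Matrix (Fin n) (Fin n) ℂ) : ℂ[X] :=
  ((X : ℂ[X]) • R.map C - K.map C).det

theorem eval_pencilDet {n : ℕ} (K R : Matrix (Fin n) (Fin n) ℂ) (z : ℂ) :
    (pencilDet K R).eval z = (z • R - K).det :=
  eval_det_toPolyMatrix ⟨R, K⟩ z

theorem natDegree_pencilDet_le {n : ℕ} (K R : Matrix (Fin n) (Fin n) ℂ) :
    (pencilDet K R).natDegree ≤ n := by
  have h := natDegree_det_X_add_C_le R (-K)
  rw [Fintype.card_fin] at h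
  have hK : (X : ℂ[X]) • R.map C - K.map C = (X : ℂ[X]) • R.map C + (-K).map C := by
    refine Matrix.ext fun i j => ?_
    simp [sub_eq_add_neg]
  rw [pencilDet, hK]
  exact h

theorem polynomial_eq_of_eval_eq_off_point {p q : ℂ[X]} (c : ℂ)
    (h : ∀ x, x ≠ c → p.eval x = q.eval x) : p = q :=
  eq_of_infinite_eval_eq p q
    ((Set.finite_singleton c).infinite_compl.mono fun x hx => h x hx)

/-- The order of vanishing at `0` is invariant under the Möbius transformation
`x ↦ x / (c - x)`. -/
theorem natTrailingDegree_eq_of_eval_moebius {p q : ℂ[X]} {n : ℕ} {a c : ℂ} (ha : a ≠ 0)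
    (hc : c ≠ 0) (hp0 : p ≠ 0) (hp : p.natDegree ≤ n)
    (h : ∀ x, x ≠ c → q.eval x = a * (c - x) ^ n * p.eval (x / (c - x))) :
    q.natTrailingDegree = p.natTrailingDegree := by
  obtain ⟨g, hg⟩ : X ^ p.natTrailingDegree ∣ p :=
    X_pow_dvd_iff.2 fun d hd => coeff_eq_zero_of_lt_natTrailingDegree hd
  set k := p.natTrailingDegree with hk
  have hg0 : g ≠ 0 := by
    rintro rfl
    exact hp0 (by simpa using hg)
  have hdeg : p.natDegree = k + g.natDegree := by
    rw [hg, natDegree_mul (pow_ne_zero _ X_ne_zero) hg0, natDegree_X_pow]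
  have hgc : g.coeff 0 ≠ 0 := by
    have h1 : p.coeff k ≠ 0 := fun h0 => hp0 (coeff_natTrailingDegree_eq_zero.1 h0)
    rw [hg, coeff_X_pow_mul'] at h1
    simpa using h1
  -- `G` is `g` homogenized to degree `n - k` in the two variables `X` and `c - X`; this clears the
  -- denominators of `g (x / (c - x))`.
  let G : ℂ[X] := ∑ i ∈ Finset.range (n - k + 1),
    C (g.coeff i) * X ^ i * (C c - X) ^ (n - k - i)
  have hG0 : G.coeff 0 = g.coeff 0 * c ^ (n - k) := by
    rw [coeff_zero_eq_eval_zero, eval_finsetSum, Finset.sum_eq_single 0]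
    · simp
    · intro i _ hi
      simp [hi]
    · simp
  have hGc : G.coeff 0 ≠ 0 := by
    rw [hG0]
    exact mul_ne_zero hgc (pow_ne_zero _ hc)
  have hq : q = (C a * G) * X ^ k := by
    refine polynomial_eq_of_eval_eq_off_point c fun x hx => ?_
    have hcx : c - x ≠ 0 := sub_ne_zero.2 hx.symm
    have hGe : G.eval x = (c - x) ^ (n - k) * g.eval (x / (c - x)) := by
      rw [eval_finsetSum, eval_eq_sum_range' (n := n - k + 1) (by omega), Finset.mul_sum]
      refine Finset.sum_congr rfl fun i hi => ?_
      have hi' : i ≤ n - k := by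
        have := Finset.mem_range.1 hi
        omega
      have hsplit : (c - x) ^ (n - k) = (c - x) ^ (n - k - i) * (c - x) ^ i := by
        rw [← pow_add]
        congr 1
        omega
      rw [hsplit]
      simp only [eval_mul, eval_C, eval_pow, eval_X, eval_sub, div_pow]
      field_simp
    have hsplit : (c - x) ^ n = (c - x) ^ (n - k) * (c - x) ^ k := by
      rw [← pow_add]
      congr 1
      omega
    rw [h x hx, hg]
    simp only [eval_mul, eval_C, eval_pow, eval_X, div_pow, hGe, hsplit]
    field_simp
  have hCG : (C a * G).coeff 0 ≠ 0 := by
    rw [coeff_C_mul]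
    exact mul_ne_zero ha hGc
  rw [hq, natTrailingDegree_mul_X_pow (fun h0 => hCG (by rw [h0, coeff_zero])),
    natTrailingDegree_eq_zero.2 (Or.inr hCG), zero_add]

/-! ### Jordan chains of two operators with `c T - D = 1` -/

section Chains

variable {V : Type*} [AddCommGroup V] [Module ℂ V] {D T : Module.End ℂ V} {c : ℂ}

theorem commute_of_smul_sub_eq_one (h : c • T - D = 1) : Commute D T := by
  have hD : D = c • T - 1 := by rw [← h]; abel
  rw [hD]
  exact ((Commute.refl T).smul_left c).sub_left (Commute.one_left T)

theorem pow_apply_chain (hDT : Commute D T) {m : ℕ} {g : ℕ → V}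
    (hg : ∀ i, i + 1 < m → D (g (i + 1)) = T (g i)) :
    ∀ i < m, (D ^ i) (g i) = (T ^ i) (g 0)
  | 0, _ => by simp
  | i + 1, hi => by
    rw [pow_succ, Module.End.mul_apply, hg i hi, ← Module.End.mul_apply,
      (hDT.pow_left i).eq, Module.End.mul_apply, pow_apply_chain hDT hg i (by omega), pow_succ',
      Module.End.mul_apply]

theorem smul_pow_apply_of_apply_eq_zero (h : c • T - D = 1) {x : V} (hx : D x = 0) (i : ℕ) :
    c ^ i • (T ^ i) x = x := by
  have h1 : c • T x = x := by
    have := congrArg (fun f : Module.End ℂ V => f x) h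
    simpa [hx] using this
  induction i with
  | zero => simp
  | succ i ih =>
    rw [pow_succ c, pow_succ T, Module.End.mul_apply, mul_smul, ← map_smul, h1, ih]

/-- `D ^ i` maps `g i` to `T ^ i (g 0)`, and `c T` is the identity on the kernel of `D`, so `T ^ i`
cannot kill `g 0`. -/
theorem pow_apply_chain_ne_zero (h : c • T - D = 1) {m : ℕ} {g : ℕ → V}
    (h00 : g 0 ≠ 0) (h0 : D (g 0) = 0) (hg : ∀ i, i + 1 < m → D (g (i + 1)) = T (g i)) {i : ℕ}
    (hi : i < m) : (D ^ i) (g i) ≠ 0 := by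
  rw [pow_apply_chain (commute_of_smul_sub_eq_one h) hg i hi]
  intro hz
  have := smul_pow_apply_of_apply_eq_zero h h0 i
  rw [hz, smul_zero] at this
  exact h00 this.symm

theorem pow_succ_apply_chain (h : c • T - D = 1) {m : ℕ} {g : ℕ → V}
    (h0 : D (g 0) = 0) (hg : ∀ i, i + 1 < m → D (g (i + 1)) = T (g i)) {i : ℕ}
    (hi : i < m) : (D ^ (i + 1)) (g i) = 0 := by
  have hDT := commute_of_smul_sub_eq_one h
  rw [pow_succ', Module.End.mul_apply, pow_apply_chain hDT hg i hi, ← Module.End.mul_apply,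
    (hDT.pow_right i).eq, Module.End.mul_apply, h0, map_zero]

/-- Every nonzero vector killed by a power of `D` is the last element of a chain. -/
theorem exists_chain_of_pow_apply_eq_zero (h : c • T - D = 1) {x : V}
    (hx0 : x ≠ 0) (hx : ∃ k, (D ^ k) x = 0) :
    ∃ (m : ℕ) (g : ℕ → V), g m = x ∧ g 0 ≠ 0 ∧ D (g 0) = 0 ∧
      ∀ i, i + 1 < m + 1 → D (g (i + 1)) = T (g i) := by
  classical
  obtain ⟨m, hm, hmin⟩ : ∃ m, (D ^ (m + 1)) x = 0 ∧ (D ^ m) x ≠ 0 := by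
    have h1 := Nat.find_spec hx
    have h2 : Nat.find hx ≠ 0 := fun h0 => hx0 (by simpa [h0] using h1)
    refine ⟨Nat.find hx - 1, ?_, Nat.find_min hx (by omega)⟩
    rwa [Nat.sub_add_cancel (by omega)]
  -- Since `c T = D + 1` and `X + 1` is prime to `X ^ (m + 1)`, a Bézout identity gives a polynomial
  -- `S` in `D` that inverts `T` on the kernel of `D ^ (m + 1)`. The chain ending in `x` is then `(S
  -- D) ^ m x, …, S D x, x`.
  have hcop : IsCoprime (X + 1 : ℂ[X]) (X ^ (m + 1)) :=
    IsCoprime.pow_right ⟨1, -1, by ring⟩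
  obtain ⟨a, b, hab⟩ := hcop
  have hT : c • T = aeval D (X + 1 : ℂ[X]) := by
    rw [map_add, aeval_X, map_one, ← h]
    abel
  let S : Module.End ℂ V := c • aeval D a
  have hST : T * S = 1 - aeval D b * D ^ (m + 1) := by
    have h1 := congrArg (aeval D) hab
    rw [map_add, map_mul, map_mul, ← hT, map_one, map_pow, aeval_X] at h1
    rw [← h1, add_sub_cancel_right]
    change T * (c • aeval D a) = _
    rw [mul_smul_comm, ← smul_mul_assoc, hT, ← map_mul, ← map_mul, mul_comm]
  have hSD : Commute S D := by
    have : Commute (aeval D a) (aeval D (X : ℂ[X])) := Commute.map (Commute.all a X) (aeval D)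
    rw [aeval_X] at this
    exact this.smul_left c
  have hTS : ∀ y, (D ^ (m + 1)) y = 0 → T (S y) = y := fun y hy => by
    rw [← Module.End.mul_apply, hST]
    simp [hy]
  have hkill : ∀ i, (D ^ (m + 1)) (((S * D) ^ i) x) = 0 := fun i => by
    rw [← Module.End.mul_apply,
      (((hSD.symm.mul_right (Commute.refl D)).pow_pow (m + 1) i)).eq, Module.End.mul_apply, hm,
      map_zero]
  have hstep : ∀ i, T (((S * D) ^ (i + 1)) x) = D (((S * D) ^ i) x) := fun i => by
    rw [pow_succ', Module.End.mul_apply, Module.End.mul_apply]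
    refine hTS _ ?_
    rw [← Module.End.mul_apply, ← pow_succ, pow_succ', Module.End.mul_apply, hkill, map_zero]
  -- Applying `T` trades one factor `S D` for `D`, so vanishing at `i` descends to `D ^ m x = 0`.
  -- The case `i = m` shows that the chain starts at a nonzero vector.
  have hTpow : ∀ i, (D ^ (m - i)) (((S * D) ^ i) x) = 0 → i ≤ m → False := by
    intro i
    induction i with
    | zero =>
      intro h0 _
      exact hmin (by simpa using h0)
    | succ i ih =>
      intro h0 hi
      refine ih ?_ (by omega)
      have hDT := commute_of_smul_sub_eq_one h
      rw [show m - i = m - (i + 1) + 1 by omega, pow_succ, Module.End.mul_apply, ← hstep,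
        ← Module.End.mul_apply, (hDT.pow_left _).eq, Module.End.mul_apply, h0, map_zero]
  refine ⟨m, fun i => ((S * D) ^ (m - i)) x, by simp, fun h0 => ?_, ?_, fun i hi => ?_⟩
  · refine hTpow m ?_ le_rfl
    have h0' : ((S * D) ^ m) x = 0 := by simpa using h0
    rw [h0', map_zero]
  · change D (((S * D) ^ (m - 0)) x) = 0
    rw [Nat.sub_zero, hSD.mul_pow, ← Module.End.mul_apply, ← mul_assoc,
      ← (hSD.pow_left m).eq, mul_assoc, ← pow_succ', Module.End.mul_apply, hm, map_zero]
  · change D (((S * D) ^ (m - (i + 1))) x) = T (((S * D) ^ (m - i)) x)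
    rw [← hstep, show m - (i + 1) + 1 = m - i by omega]

end Chains

/-! ### Root subspaces as generalized eigenspaces, and their dimension -/

variable {n : ℕ}

theorem exists_ne_zero_det_ne_zero {K R : Matrix (Fin n) (Fin n) ℂ} (h : pencilDet K R ≠ 0) :
    ∃ c : ℂ, c ≠ 0 ∧ (c • R - K).det ≠ 0 := by
  by_contra! hc
  refine h (polynomial_eq_of_eval_eq_off_point 0 fun x hx => ?_)
  rw [eval_pencilDet, hc x hx, eval_zero]

/-- The determinant whose order of vanishing at `0` is the algebraic multiplicity of the point. -/
noncomputable def localDet (𝒜 : MatrixPencil n) (l : OnePoint ℂ) : ℂ[X] :=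
  pencilDet (𝒜.chainMatrices l).1 (𝒜.chainMatrices l).2

theorem toLin_resolvent_sub {K R : Matrix (Fin n) (Fin n) ℂ} {c : ℂ}
    (hc : (c • R - K).det ≠ 0) :
    c • Matrix.toLin' ((c • R - K)⁻¹ * R) - Matrix.toLin' ((c • R - K)⁻¹ * K) = 1 := by
  rw [← map_smul, ← map_sub, ← Matrix.mul_smul, ← Matrix.mul_sub,
    Matrix.nonsing_inv_mul _ (isUnit_iff_ne_zero.2 hc), Matrix.toLin'_one]
  rfl

theorem toLin_resolvent_eq_iff {K R N : Matrix (Fin n) (Fin n) ℂ} (hN : N.det ≠ 0)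
    (x y : Fin n → ℂ) :
    Matrix.toLin' (N⁻¹ * K) x = Matrix.toLin' (N⁻¹ * R) y ↔ K.mulVec x = R.mulVec y := by
  have hu : IsUnit N.det := isUnit_iff_ne_zero.2 hN
  rw [Matrix.toLin'_apply, Matrix.toLin'_apply, ← Matrix.mulVec_mulVec, ← Matrix.mulVec_mulVec]
  refine ⟨fun h => ?_, fun h => by rw [h]⟩
  have := congrArg N.mulVec h
  simpa [Matrix.mulVec_mulVec, ← mul_assoc, Matrix.mul_nonsing_inv _ hu] using this

theorem toLin_resolvent_eq_zero_iff {K N : Matrix (Fin n) (Fin n) ℂ} (hN : N.det ≠ 0)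
    (x : Fin n → ℂ) : Matrix.toLin' (N⁻¹ * K) x = 0 ↔ K.mulVec x = 0 := by
  simpa using toLin_resolvent_eq_iff (K := K) (R := K) hN x 0

/-- With `N = c R - K`, the operators `D = N⁻¹ K` and `T = N⁻¹ R` satisfy `c T - D = 1` and have the
same chains as `(K, R)`; the elements of these chains are the nonzero vectors killed by a power of
`D`. -/
theorem rootSubspace_eq_maxGenEigenspace (𝒜 : MatrixPencil n) (l : OnePoint ℂ) {c : ℂ}
    (hN : (c • (𝒜.chainMatrices l).2 - (𝒜.chainMatrices l).1).det ≠ 0) :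
    𝒜.rootSubspace l = Module.End.maxGenEigenspace
      (Matrix.toLin' ((c • (𝒜.chainMatrices l).2 - (𝒜.chainMatrices l).1)⁻¹ *
        (𝒜.chainMatrices l).1)) 0 := by
  have h1 := toLin_resolvent_sub hN
  apply le_antisymm
  · refine Submodule.span_le.2 ?_
    rintro x ⟨m, g, hg, j, hj, rfl⟩
    obtain ⟨-, -, h0, hs⟩ := (𝒜.isJordanChain_iff l m g).1 hg
    rw [SetLike.mem_coe, Module.End.mem_maxGenEigenspace]
    refine ⟨j + 1, ?_⟩
    rw [zero_smul, sub_zero]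
    exact pow_succ_apply_chain h1 ((toLin_resolvent_eq_zero_iff hN _).2 h0)
      (fun i hi => (toLin_resolvent_eq_iff hN _ _).2 (hs i hi)) hj
  · intro x hx
    rw [Module.End.mem_maxGenEigenspace, zero_smul, sub_zero] at hx
    by_cases hx0 : x = 0
    · rw [hx0]
      exact zero_mem _
    obtain ⟨m, g, hgm, hg0, h0, hs⟩ := exists_chain_of_pow_apply_eq_zero h1 hx0 hx
    exact Submodule.subset_span ⟨m + 1, g, (𝒜.isJordanChain_iff l _ g).2 ⟨m.succ_pos, hg0,
      (toLin_resolvent_eq_zero_iff hN _).1 h0,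
      fun i hi => (toLin_resolvent_eq_iff hN _ _).1 (hs i hi)⟩, m, m.lt_succ_self, hgm⟩

theorem natTrailingDegree_charpoly_resolvent {K R : Matrix (Fin n) (Fin n) ℂ} {c : ℂ}
    (hc : c ≠ 0) (hN : (c • R - K).det ≠ 0) :
    (pencilDet K R).natTrailingDegree = ((c • R - K)⁻¹ * K).charpoly.natTrailingDegree := by
  set N := c • R - K with hNdef
  have hu : IsUnit N.det := isUnit_iff_ne_zero.2 hN
  refine natTrailingDegree_eq_of_eval_moebius (n := n) (a := N.det * (c⁻¹) ^ n)
    (mul_ne_zero hN (pow_ne_zero _ (inv_ne_zero hc))) hc (Matrix.charpoly_monic _).ne_zero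
    (by simp) fun x hx => ?_
  have hcx : c - x ≠ 0 := sub_ne_zero.2 hx.symm
  -- Both sides equal `c⁻¹ (x N - (c - x) K)`. This factorization is the source of the Möbius
  -- substitution.
  have hmat : x • R - K = N * (c⁻¹ • ((c - x) • (Matrix.scalar (Fin n) (x / (c - x)) - N⁻¹ * K))) := by
    have hs : Matrix.scalar (Fin n) (x / (c - x)) = (x / (c - x)) • (1 : Matrix (Fin n) (Fin n) ℂ) := by
      rw [Matrix.smul_one_eq_diagonal]; rfl
    rw [hs, smul_sub, smul_smul, mul_div_cancel₀ _ hcx, Matrix.mul_smul, Matrix.mul_sub,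
      Matrix.mul_smul, Matrix.mul_smul, mul_one, ← mul_assoc, Matrix.mul_nonsing_inv _ hu, one_mul,
      hNdef]
    ext i j
    simp only [Matrix.sub_apply, Matrix.smul_apply, smul_eq_mul]
    field_simp
    ring
  rw [eval_pencilDet, hmat, Matrix.det_mul, Matrix.det_smul, Matrix.det_smul, Matrix.eval_charpoly,
    Fintype.card_fin]
  ring

theorem finrank_rootSubspace {𝒜 : MatrixPencil n} {l : OnePoint ℂ} (h : 𝒜.localDet l ≠ 0) :
    Module.finrank ℂ (𝒜.rootSubspace l) = (𝒜.localDet l).natTrailingDegree := by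
  obtain ⟨c, hc, hN⟩ := exists_ne_zero_det_ne_zero h
  rw [𝒜.rootSubspace_eq_maxGenEigenspace l hN, LinearMap.finrank_maxGenEigenspace_zero_eq,
    Matrix.charpoly_toLin', localDet, natTrailingDegree_charpoly_resolvent hc hN]

/-! ### Chain lengths and the pole of the inverse -/

/-- The last vector of the chain is killed by `D ^ m` but not by `D ^ (m - 1)`, while the kernels of
the powers of `D` are constant from exponent `n` on. -/
theorem IsJordanChain.length_le {𝒜 : MatrixPencil n} {l : OnePoint ℂ} (h : 𝒜.localDet l ≠ 0)
    {m : ℕ} {g : ℕ → Fin n → ℂ} (hg : 𝒜.IsJordanChain l m g) : m ≤ n := by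
  obtain ⟨c, hc, hN⟩ := exists_ne_zero_det_ne_zero h
  have h1 := toLin_resolvent_sub hN
  obtain ⟨hm, hg0, h0, hs⟩ := (𝒜.isJordanChain_iff l m g).1 hg
  replace h0 := (toLin_resolvent_eq_zero_iff hN _).2 h0
  replace hs := fun i hi => (toLin_resolvent_eq_iff hN _ _).2 (hs i hi)
  have hlt : m - 1 < m := by omega
  have hne := pow_apply_chain_ne_zero h1 hg0 h0 hs hlt
  have hz := pow_succ_apply_chain h1 h0 hs hlt
  by_contra! hnm
  refine hne ?_
  have hfin : Module.finrank ℂ (Fin n → ℂ) = n := by simp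
  rw [← LinearMap.mem_ker, Module.End.ker_pow_eq_ker_pow_finrank_of_le (by omega)] at hz ⊢
  exact hz

theorem IsJordanChain.length_le_maxChainLength {𝒜 : MatrixPencil n} {l : OnePoint ℂ}
    (h : 𝒜.localDet l ≠ 0) {m : ℕ} {g : ℕ → Fin n → ℂ} (hg : 𝒜.IsJordanChain l m g) :
    m ≤ 𝒜.maxChainLength l :=
  le_csSup ⟨n, fun _ ⟨_, hk⟩ => hk.length_le h⟩ ⟨g, hg⟩

/-- The pole of the inverse of the pencil at `l` has order at most the length of the longest Jordan
chain: the principal part of a column of the inverse is a Jordan chain. -/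
theorem X_pow_dvd_adjugate {𝒜 : MatrixPencil n} {l : OnePoint ℂ} (h : 𝒜.localDet l ≠ 0)
    (i j : Fin n) :
    X ^ ((𝒜.localDet l).natTrailingDegree - 𝒜.maxChainLength l) ∣
      ((X : ℂ[X]) • (𝒜.chainMatrices l).2.map C - (𝒜.chainMatrices l).1.map C).adjugate i j := by
  classical
  set K := (𝒜.chainMatrices l).1 with hK
  set R := (𝒜.chainMatrices l).2 with hR
  set B := ((X : ℂ[X]) • R.map C - K.map C).adjugate with hB
  set v := (𝒜.localDet l).natTrailingDegree with hv
  rw [X_pow_dvd_iff]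
  by_contra! hcon
  have hex : ∃ d, ∃ i j, (B i j).coeff d ≠ 0 := by
    obtain ⟨d, -, hd⟩ := hcon
    exact ⟨d, i, j, hd⟩
  -- `w` is the lowest power of `X` occurring in the adjugate. Below degree `v`, the identity
  -- "pencil times adjugate is the determinant" has no right-hand side, so the coefficients of
  -- column `j₀` in degrees `w, …, v - 1` form a chain of length `v - w`, which is too long.
  obtain ⟨w, ⟨i₀, j₀, hw⟩, hmin, hwlt⟩ : ∃ w, (∃ i j, (B i j).coeff w ≠ 0) ∧
      (∀ d < w, ∀ i j, (B i j).coeff d = 0) ∧ w < v - 𝒜.maxChainLength l := by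
    refine ⟨Nat.find hex, Nat.find_spec hex, fun d hd i j => ?_, ?_⟩
    · by_contra hne
      exact Nat.find_min hex hd ⟨i, j, hne⟩
    · obtain ⟨d, hd, hdn⟩ := hcon
      exact (Nat.find_min' hex ⟨i, j, hdn⟩).trans_lt hd
  have hmul : ∀ a, X * ∑ k, C (R a k) * B k j₀ - ∑ k, C (K a k) * B k j₀ =
      𝒜.localDet l * (1 : Matrix (Fin n) (Fin n) ℂ[X]) a j₀ := fun a => by
    have := congrFun (congrFun (Matrix.mul_adjugate ((X : ℂ[X]) • R.map C - K.map C)) a) j₀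
    rw [Matrix.sub_mul, Matrix.smul_mul] at this
    simpa [Matrix.mul_apply, localDet, pencilDet] using this
  have hcoeff0 : ∀ a, ∀ d < v, (𝒜.localDet l * (1 : Matrix (Fin n) (Fin n) ℂ[X]) a j₀).coeff d = 0 :=
    fun a d hd => by
      rw [Matrix.one_apply]
      split_ifs
      · rw [mul_one]
        exact coeff_eq_zero_of_lt_natTrailingDegree hd
      · simp
  have hmv : ∀ (M : Matrix (Fin n) (Fin n) ℂ) a d,
      (∑ k, C (M a k) * B k j₀).coeff d = M.mulVec (fun k => (B k j₀).coeff d) a :=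
    fun M a d => by simp [Matrix.mulVec, dotProduct]
  have hsucc : ∀ d, d + 1 < v → K.mulVec (fun k => (B k j₀).coeff (d + 1)) =
      R.mulVec (fun k => (B k j₀).coeff d) := fun d hd => by
    ext a
    have := congrArg (fun p => p.coeff (d + 1)) (hmul a)
    simp only [coeff_sub, coeff_X_mul] at this
    rw [hmv, hmv, hcoeff0 a _ hd, sub_eq_zero] at this
    exact this.symm
  have hzero : K.mulVec (fun k => (B k j₀).coeff w) = 0 := by
    rcases w with - | w
    · ext a
      have := congrArg (fun p => p.coeff 0) (hmul a)
      simp only [coeff_sub, coeff_X_mul_zero] at this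
      rw [hmv, hcoeff0 a _ (by omega), zero_sub, neg_eq_zero] at this
      exact this
    · rw [hsucc w (by omega)]
      have : (fun k => (B k j₀).coeff w) = 0 := funext fun k => hmin w w.lt_succ_self k j₀
      rw [this, Matrix.mulVec_zero]
  have hchain : 𝒜.IsJordanChain l (v - w) fun t k => (B k j₀).coeff (w + t) := by
    refine (𝒜.isJordanChain_iff l _ _).2 ⟨by omega, fun h0 => hw (congrFun h0 i₀), hzero,
      fun t ht => hsucc (w + t) (by omega)⟩
  have := hchain.length_le_maxChainLength h
  omega

/-! ### Determinants under rank one perturbations -/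

theorem minor_two_eq_of_rank_eq_one {P : MatrixPencil n} (hP : P.rank = 1) (i j k m : Fin n) :
    P.toPolyMatrix i j * P.toPolyMatrix k m = P.toPolyMatrix i m * P.toPolyMatrix k j := by
  by_cases hik : i = k
  · rw [hik, mul_comm]
  by_cases hjm : j = m
  · rw [hjm]
  by_contra hne
  have hbdd : BddAbove {r : ℕ | ∃ f g : Fin r ↪ Fin n,
      (P.toPolyMatrix.submatrix f g).det ≠ 0} :=
    ⟨n, fun r ⟨f, _⟩ => by simpa using Fintype.card_le_of_embedding f⟩
  have hinj : ∀ {a b : Fin n}, a ≠ b → Function.Injective ![a, b] := fun {a b} hab => by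
    intro x y
    fin_cases x <;> fin_cases y <;> simp [hab, hab.symm]
  have h2 : 2 ≤ P.rank := by
    refine le_csSup hbdd ⟨⟨![i, k], hinj hik⟩, ⟨![j, m], hinj hjm⟩, ?_⟩
    rw [Matrix.det_fin_two]
    simpa [sub_eq_zero] using hne
  omega

/-- A `2 × 2` minor of `s E - A` is quadratic in `s`, and its three coefficients vanish; they are
also the coefficients of the minor of `p E + q A` as a form in `p, q`. One statement thus serves
finite points and infinity. -/
theorem combination_minor_two_eq {P : MatrixPencil n} (hP : P.rank = 1) (p q : ℂ[X])
    (i j k m : Fin n) :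
    (p • P.E.map C + q • P.A.map C) i j * (p • P.E.map C + q • P.A.map C) k m =
      (p • P.E.map C + q • P.A.map C) i m * (p • P.E.map C + q • P.A.map C) k j := by
  have h := minor_two_eq_of_rank_eq_one hP i j k m
  have heval : ∀ z : ℂ, (z * P.E i j - P.A i j) * (z * P.E k m - P.A k m) =
      (z * P.E i m - P.A i m) * (z * P.E k j - P.A k j) := fun z => by
    simpa [toPolyMatrix, mul_comm z] using congrArg (Polynomial.eval z) h
  have h0 : C (P.A i j) * C (P.A k m) = C (P.A i m) * C (P.A k j) := by
    rw [← C_mul, ← C_mul]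
    congr 1
    linear_combination heval 0
  have h2 : C (P.E i j) * C (P.E k m) = C (P.E i m) * C (P.E k j) := by
    rw [← C_mul, ← C_mul]
    congr 1
    linear_combination (heval 1 + heval (-1)) / 2 - heval 0
  have h1 : C (P.E i j) * C (P.A k m) + C (P.A i j) * C (P.E k m) =
      C (P.E i m) * C (P.A k j) + C (P.A i m) * C (P.E k j) := by
    rw [← C_mul, ← C_mul, ← C_mul, ← C_mul, ← C_add, ← C_add]
    congr 1
    linear_combination (heval (-1) - heval 1) / 2
  simp only [Matrix.add_apply, Matrix.smul_apply, Matrix.map_apply, smul_eq_mul]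
  linear_combination p ^ 2 * h2 + q ^ 2 * h0 + p * q * h1

/-- First order expansion of the determinant under a perturbation all of whose `2 × 2` minors
vanish. -/
theorem det_add_of_minor_two_eq {F : Type*} [Field F] {M Q : Matrix (Fin n) (Fin n) F}
    (hM : M.det ≠ 0) (hQ : ∀ i j k m, Q i j * Q k m = Q i m * Q k j) :
    (M + Q).det = M.det + ∑ i, ∑ j, M.adjugate i j * Q j i := by
  by_cases h0 : Q = 0
  · simp [h0]
  obtain ⟨a, b, hab⟩ : ∃ a b, Q a b ≠ 0 := by
    by_contra! h
    exact h0 (Matrix.ext h)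
  -- `Q` is column `b` times row `a`, normalized by the pivot `Q a b`, so the matrix determinant
  -- lemma applies.
  have hQ' : Q = Matrix.replicateCol Unit (fun i => Q i b) *
      Matrix.replicateRow Unit (fun j => Q a j / Q a b) := by
    ext i j
    simp only [Matrix.mul_apply, Matrix.replicateCol_apply, Matrix.replicateRow_apply,
      Finset.univ_unique, Finset.sum_singleton]
    field_simp
    exact hQ i j a b
  have hsum : ∀ i j, Q j i = Q j b * (Q a i / Q a b) := fun i j => by
    field_simp
    exact hQ j i a b
  conv_lhs => rw [hQ']
  rw [Matrix.det_add_replicateCol_mul_replicateRow (isUnit_iff_ne_zero.2 hM),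
    Matrix.det_unique (n := Unit)]
  simp only [Matrix.add_apply, Matrix.one_apply_eq, Matrix.mul_apply, Matrix.replicateCol_apply,
    Matrix.replicateRow_apply, Matrix.inv_def, Ring.inverse_eq_inv, Matrix.smul_apply, smul_eq_mul]
  rw [mul_add, mul_one, Finset.mul_sum, Finset.sum_comm]
  congr 1
  refine Finset.sum_congr rfl fun j _ => ?_
  rw [Finset.sum_mul, Finset.mul_sum]
  refine Finset.sum_congr rfl fun i _ => ?_
  rw [hsum i j]
  field_simp

/-- The formula contains no inverse and is compatible with ring homomorphisms, so it can be checked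
in the fraction field, where `M` is invertible. -/
theorem det_add_of_minor_two_eq_of_isDomain {S : Type*} [CommRing S] [IsDomain S]
    {M Q : Matrix (Fin n) (Fin n) S} (hM : M.det ≠ 0)
    (hQ : ∀ i j k m, Q i j * Q k m = Q i m * Q k j) :
    (M + Q).det = M.det + ∑ i, ∑ j, M.adjugate i j * Q j i := by
  let φ := algebraMap S (FractionRing S)
  have hφ : Function.Injective φ := IsFractionRing.injective S (FractionRing S)
  apply hφ
  have hdet : ∀ N : Matrix (Fin n) (Fin n) S, φ N.det = (φ.mapMatrix N).det := φ.map_det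
  have hadj : ∀ i j, φ (M.adjugate i j) = (φ.mapMatrix M).adjugate i j := fun i j => by
    rw [← φ.map_adjugate]
    rfl
  simp only [map_add, map_sum, map_mul, hadj, hdet]
  refine det_add_of_minor_two_eq ?_ fun i j k m => ?_
  · rw [← hdet]
    exact (map_ne_zero_iff φ hφ).2 hM
  · simp only [RingHom.mapMatrix_apply, Matrix.map_apply, ← map_mul]
    rw [hQ]

/-! ### Multiplicities at finite points and at infinity; total dimension -/

theorem localDet_coe (𝒜 : MatrixPencil n) (z : ℂ) :
    𝒜.localDet z = 𝒜.toPolyMatrix.det.comp (X + C z) := by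
  refine Polynomial.funext fun x => ?_
  rw [eval_comp, eval_det_toPolyMatrix, localDet, eval_pencilDet]
  change (x • 𝒜.E - (𝒜.A - z • 𝒜.E)).det = _
  congr 1
  simp only [eval, eval_add, eval_X, eval_C, add_smul]
  abel

/-- For `x ≠ 0`, `x A - E = -x (x⁻¹ E - A)`, so infinity sees the coefficients of the characteristic
polynomial reversed from degree `n`, not from its own degree. -/
theorem localDet_infty (𝒜 : MatrixPencil n) :
    𝒜.localDet OnePoint.infty = C ((-1) ^ n) * reflect n 𝒜.toPolyMatrix.det := by
  refine polynomial_eq_of_eval_eq_off_point 0 fun x hx => ?_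
  have hinv : Invertible x⁻¹ := invertibleOfNonzero (inv_ne_zero hx)
  have h := eval₂_reflect_mul_pow (RingHom.id ℂ) x⁻¹ n 𝒜.toPolyMatrix.det
    (natDegree_pencilDet_le 𝒜.A 𝒜.E)
  rw [invOf_eq_inv, inv_inv, eval₂_id, eval₂_id, eval_det_toPolyMatrix] at h
  have hr : (reflect n 𝒜.toPolyMatrix.det).eval x = x ^ n * (𝒜.eval x⁻¹).det := by
    rw [← h, inv_pow]
    field_simp
  have hmat : x • 𝒜.A - 𝒜.E = (-x) • 𝒜.eval x⁻¹ := by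
    rw [eval, smul_sub, smul_smul, neg_mul, mul_inv_cancel₀ hx]
    simp only [neg_smul, one_smul]
    abel
  rw [eval_mul, eval_C, hr, localDet, eval_pencilDet]
  change (x • 𝒜.A - 𝒜.E).det = _
  rw [hmat, Matrix.det_smul, Fintype.card_fin, neg_pow]
  ring

theorem natTrailingDegree_localDet_coe (𝒜 : MatrixPencil n) (z : ℂ) :
    (𝒜.localDet z).natTrailingDegree = 𝒜.toPolyMatrix.det.rootMultiplicity z := by
  rw [localDet_coe, rootMultiplicity_eq_natTrailingDegree]

theorem IsRegular.localDet_ne_zero {𝒜 : MatrixPencil n} (h : 𝒜.IsRegular) (l : OnePoint ℂ) :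
    𝒜.localDet l ≠ 0 := by
  induction l using OnePoint.rec with
  | infty =>
    rw [localDet_infty]
    exact mul_ne_zero (by simp) (mt reflect_eq_zero_iff.1 h)
  | coe z =>
    rw [localDet_coe]
    exact (comp_X_add_C_ne_zero_iff).2 h

theorem IsRegular.natTrailingDegree_localDet_infty {𝒜 : MatrixPencil n} (h : 𝒜.IsRegular) :
    (𝒜.localDet OnePoint.infty).natTrailingDegree = n - 𝒜.toPolyMatrix.det.natDegree := by
  have hd : 𝒜.toPolyMatrix.det.natDegree ≤ n := natDegree_pencilDet_le 𝒜.A 𝒜.E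
  have hcoeff : ∀ k ≤ n, (𝒜.localDet OnePoint.infty).coeff k =
      (-1) ^ n * 𝒜.toPolyMatrix.det.coeff (n - k) := fun k hk => by
    rw [localDet_infty, coeff_C_mul, coeff_reflect, revAt_le hk]
  apply le_antisymm
  · refine natTrailingDegree_le_of_ne_zero ?_
    rw [hcoeff _ (Nat.sub_le _ _), Nat.sub_sub_self hd]
    exact mul_ne_zero (by simp) (leadingCoeff_ne_zero.2 h)
  · refine le_natTrailingDegree (h.localDet_ne_zero _) fun k hk => ?_
    rw [hcoeff k (by omega), coeff_eq_zero_of_natDegree_lt (by omega), mul_zero]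

theorem IsRegular.finrank_rootSubspace_eq_zero {𝒜 : MatrixPencil n} (h : 𝒜.IsRegular)
    {l : OnePoint ℂ} (hl : l ∉ 𝒜.spectrum) : Module.finrank ℂ (𝒜.rootSubspace l) = 0 := by
  rw [finrank_rootSubspace (h.localDet_ne_zero l)]
  induction l using OnePoint.rec with
  | infty =>
    have hE : IsUnit 𝒜.E := not_not.1 hl
    refine natTrailingDegree_eq_zero.2 (Or.inr ?_)
    rw [coeff_zero_eq_eval_zero, localDet, eval_pencilDet]
    change ((0 : ℂ) • 𝒜.A - 𝒜.E).det ≠ 0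
    rw [zero_smul, zero_sub]
    exact ((Matrix.isUnit_iff_isUnit_det _).1 hE.neg).ne_zero
  | coe z =>
    rw [natTrailingDegree_localDet_coe]
    exact rootMultiplicity_eq_zero fun hr => hl ((𝒜.coe_mem_spectrum_iff z).2 hr)

/-- The root subspaces of a regular pencil have total dimension `n`. -/
theorem IsRegular.sum_finrank_rootSubspace {𝒜 : MatrixPencil n} (h : 𝒜.IsRegular)
    (S : Finset (OnePoint ℂ)) (hS : 𝒜.spectrum ⊆ S) :
    ∑ l ∈ S, Module.finrank ℂ (𝒜.rootSubspace l) = n := by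
  classical
  have hsupp : (Function.support fun l => Module.finrank ℂ (𝒜.rootSubspace l)) ⊆ 𝒜.spectrum :=
    fun l hl => by
      by_contra hn
      exact hl (h.finrank_rootSubspace_eq_zero hn)
  let p := 𝒜.toPolyMatrix.det
  let S' : Finset (OnePoint ℂ) :=
    insert OnePoint.infty (p.roots.toFinset.map ⟨OnePoint.some, OnePoint.coe_injective⟩)
  have hS' : 𝒜.spectrum ⊆ S' := fun l hl => by
    induction l using OnePoint.rec with
    | infty => simp [S']
    | coe z =>
      have : p.IsRoot z := (𝒜.coe_mem_spectrum_iff z).1 hl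
      simp only [S', Finset.coe_insert, Finset.coe_map]
      refine Or.inr ⟨z, ?_, rfl⟩
      simpa using (mem_roots h).2 this
  -- The sum may be taken over infinity and the roots: infinity contributes `n - deg p`, the roots
  -- `deg p`.
  rw [← finsum_eq_sum_of_support_subset _ (hsupp.trans hS),
    finsum_eq_sum_of_support_subset _ (hsupp.trans hS'), Finset.sum_insert (by simp),
    Finset.sum_map, finrank_rootSubspace (h.localDet_ne_zero _),
    h.natTrailingDegree_localDet_infty]
  have hroots : ∑ z ∈ p.roots.toFinset, Module.finrank ℂ (𝒜.rootSubspace (z : OnePoint ℂ)) =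
      p.natDegree := by
    rw [← IsAlgClosed.card_roots_eq_natDegree, ← Multiset.toFinset_sum_count_eq]
    refine Finset.sum_congr rfl fun z _ => ?_
    rw [finrank_rootSubspace (h.localDet_ne_zero _), natTrailingDegree_localDet_coe, count_roots]
  have hd : p.natDegree ≤ n := natDegree_pencilDet_le 𝒜.A 𝒜.E
  exact (congrArg (n - p.natDegree + ·) hroots).trans (Nat.sub_add_cancel hd)

/-! ### The local lower bound -/

theorem chainMatrices_add (𝒜 P : MatrixPencil n) (l : OnePoint ℂ) :
    (𝒜 + P).chainMatrices l = 𝒜.chainMatrices l + P.chainMatrices l := by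
  induction l using OnePoint.rec with
  | infty => rfl
  | coe z =>
    change (𝒜.A + P.A - z • (𝒜.E + P.E), 𝒜.E + P.E) =
      (𝒜.A - z • 𝒜.E + (P.A - z • P.E), 𝒜.E + P.E)
    rw [smul_add, add_sub_add_comm]

theorem exists_chainMatrices_eq_combination (P : MatrixPencil n) (l : OnePoint ℂ) :
    ∃ p q : ℂ[X], (X : ℂ[X]) • (P.chainMatrices l).2.map C - (P.chainMatrices l).1.map C =
      p • P.E.map C + q • P.A.map C := by
  induction l using OnePoint.rec with
  | infty =>
    refine ⟨-1, X, ?_⟩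
    change (X : ℂ[X]) • P.A.map C - P.E.map C = _
    rw [neg_smul, one_smul]
    abel
  | coe z =>
    refine ⟨X + C z, -1, ?_⟩
    change (X : ℂ[X]) • P.E.map C - (P.A - z • P.E).map C = _
    refine Matrix.ext fun i j => ?_
    simp only [Matrix.sub_apply, Matrix.smul_apply, Matrix.map_apply, Matrix.add_apply,
      smul_eq_mul, C_sub, C_mul]
    ring

/-- In the first order expansion both `localDet` of the unperturbed pencil and every adjugate entry
are divisible by `X ^ (v - m₁)`. If `m₁` exceeded `v`, the truncated exponent `0` would be harmless.
-/
theorem IsRegular.finrank_rootSubspace_le_add {𝒜 P : MatrixPencil n} (hA : 𝒜.IsRegular)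
    (hP : P.rank = 1) (hAP : (𝒜 + P).IsRegular) (l : OnePoint ℂ) :
    Module.finrank ℂ (𝒜.rootSubspace l) ≤
      Module.finrank ℂ ((𝒜 + P).rootSubspace l) + 𝒜.maxChainLength l := by
  have hA' := hA.localDet_ne_zero l
  have hAP' := hAP.localDet_ne_zero l
  rw [finrank_rootSubspace hA', finrank_rootSubspace hAP', ← Nat.sub_le_iff_le_add]
  obtain ⟨p, q, hpq⟩ := P.exists_chainMatrices_eq_combination l
  have hmat : (X : ℂ[X]) • ((𝒜 + P).chainMatrices l).2.map C -
      ((𝒜 + P).chainMatrices l).1.map C =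
      ((X : ℂ[X]) • (𝒜.chainMatrices l).2.map C - (𝒜.chainMatrices l).1.map C) +
        (p • P.E.map C + q • P.A.map C) := by
    rw [← hpq, chainMatrices_add]
    refine Matrix.ext fun i j => ?_
    simp only [Matrix.sub_apply, Matrix.smul_apply, Matrix.map_apply, Matrix.add_apply,
      smul_eq_mul, C_add, Prod.fst_add, Prod.snd_add]
    ring
  have hdet : (𝒜 + P).localDet l = 𝒜.localDet l + ∑ i, ∑ j,
      ((X : ℂ[X]) • (𝒜.chainMatrices l).2.map C - (𝒜.chainMatrices l).1.map C).adjugate i j *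
        (p • P.E.map C + q • P.A.map C) j i := by
    rw [localDet, pencilDet, hmat]
    exact det_add_of_minor_two_eq_of_isDomain hA' (combination_minor_two_eq hP p q)
  have hdvd : X ^ ((𝒜.localDet l).natTrailingDegree - 𝒜.maxChainLength l) ∣
      (𝒜 + P).localDet l := by
    rw [hdet]
    refine dvd_add (X_pow_dvd_iff.2 fun d hd => coeff_eq_zero_of_lt_natTrailingDegree (by omega))
      (Finset.dvd_sum fun i _ => Finset.dvd_sum fun j _ => ?_)
    exact Dvd.dvd.mul_right (X_pow_dvd_adjugate hA' i j) _
  exact le_natTrailingDegree hAP' (X_pow_dvd_iff.1 hdvd)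

end MatrixPencil

/-! ### The global bounds by counting dimensions -/

theorem theorem4p4 {n : ℕ} (𝒜 P : MatrixPencil n) (hA : 𝒜.IsRegular) (hP : P.rank = 1)
    (hAP : (𝒜 + P).IsRegular) :
    (∀ l ∈ 𝒜.spectrum,
      (Module.finrank ℂ (𝒜.rootSubspace l) : ℤ) - 𝒜.maxChainLength l
          ≤ Module.finrank ℂ ((𝒜 + P).rootSubspace l) ∧
      (Module.finrank ℂ ((𝒜 + P).rootSubspace l) : ℤ)
          ≤ Module.finrank ℂ (𝒜.rootSubspace l) + 𝒜.sumMaxChainLength - 𝒜.maxChainLength l) ∧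
    (∀ l ∉ 𝒜.spectrum,
      0 ≤ Module.finrank ℂ ((𝒜 + P).rootSubspace l) ∧
      Module.finrank ℂ ((𝒜 + P).rootSubspace l) ≤ 𝒜.sumMaxChainLength) ∧
    (n : ℤ) - 𝒜.sumMaxChainLength
        ≤ ((∑ᶠ l ∈ 𝒜.spectrum, Module.finrank ℂ ((𝒜 + P).rootSubspace l) : ℕ) : ℤ) ∧
    (∑ᶠ l ∈ (𝒜 + P).spectrum \ 𝒜.spectrum, Module.finrank ℂ ((𝒜 + P).rootSubspace l))
        ≤ 𝒜.sumMaxChainLength := by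
  classical
  obtain ⟨S, hS⟩ := hA.finite_spectrum.exists_finset_coe
  obtain ⟨S', hS'⟩ := hAP.finite_spectrum.exists_finset_coe
  have hmem : ∀ l, l ∈ 𝒜.spectrum ↔ l ∈ S := fun l => by rw [← hS, Finset.mem_coe]
  have hkey := hA.finrank_rootSubspace_le_add hP hAP
  have hn : ∑ l ∈ S, Module.finrank ℂ (𝒜.rootSubspace l) = n :=
    hA.sum_finrank_rootSubspace S hS.ge
  have hM : 𝒜.sumMaxChainLength = ∑ l ∈ S, 𝒜.maxChainLength l := by
    rw [MatrixPencil.sumMaxChainLength, ← hS, finsum_mem_coe_finset]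
  have hle : ∀ U : Finset (OnePoint ℂ), ∑ l ∈ U, Module.finrank ℂ ((𝒜 + P).rootSubspace l) ≤ n :=
    fun U => (Finset.sum_le_sum_of_subset Finset.subset_union_left).trans
      (hAP.sum_finrank_rootSubspace (U ∪ S') (by rw [← hS']; simp)).le
  have hlow : ∀ U : Finset (OnePoint ℂ), ∑ l ∈ U, Module.finrank ℂ (𝒜.rootSubspace l) ≤
      ∑ l ∈ U, Module.finrank ℂ ((𝒜 + P).rootSubspace l) + ∑ l ∈ U, 𝒜.maxChainLength l :=
    fun U => by
      rw [← Finset.sum_add_distrib]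
      exact Finset.sum_le_sum fun l _ => hkey l
  have hlowS := hlow S
  refine ⟨fun l hl => ⟨?_, ?_⟩, fun l hl => ⟨Nat.zero_le _, ?_⟩, ?_, ?_⟩
  · have := hkey l
    omega
  -- The points of `S` other than `l` lose at most `M - m₁(l)` in total, and the sum over `S` cannot
  -- exceed its old value `n`.
  · have hl' := (hmem l).1 hl
    have h1 := hle S
    have h2 := hlow (S.erase l)
    rw [← Finset.add_sum_erase S _ hl'] at h1 hn hM
    omega
  · have hl' : l ∉ S := mt (hmem l).2 hl
    have h1 := hle (insert l S)
    rw [Finset.sum_insert hl'] at h1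
    omega
  · rw [← hS, finsum_mem_coe_finset]
    omega
  · rw [← hS, ← hS', ← Finset.coe_sdiff, finsum_mem_coe_finset]
    -- The points of `S` keep at least `n - M` of the total `n`, leaving at most `M` for new
    -- eigenvalues.
    have h1 := hle (S' \ S ∪ S)
    rw [Finset.sum_union Finset.sdiff_disjoint] at h1
    omega
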